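/- For a finite group $G$, the enhanced power graph $\mathcal{G}_E(G)$ has vertex set $G$, two distinct elements being adjacent if and only if both lie in $\langle w\rangle$ for some $w\in G$; the proper enhanced power graph $\mathcal{G}_E^{**}(G)$ is obtained from it by deleting all dominating vertices (those adjacent to every other vertex). The strong domination number $\gamma^{\text{strong}}(\Gamma)$ of a graph $\Gamma$ is the least size of a set $D$ of vertices such that every vertex of $\Gamma$ (including those in $D$) has a neighbour in $D$. For $k\ge 3$ let $Q_{2^k}$ be the generalized quaternion group of order $2^k$. Let $G$ be a finite nilpotent group whose Sylow $2$-subgroup is isomorphic to $Q_{2^k}$, $k\geq 3$. Below, $n$ is a positive integer, and $G_1$ is a nontrivial finite nilpotent group such that for every prime $p$ dividing $|G_1|$ the Sylow $p$-subgroup of $G_1$ is neither cyclic nor generalized quaternion; $r_1$ is the minimum, over the primes $p$ dividing $|G_1|$, of the number of subgroups of order $p$ in the Sylow $p$-subgroup of $G_1$. Then $G\cong \mathbb{Z}_n\times Q_{2^k}$ or $G\cong G_1\times\mathbb{Z}_n\times Q_{2^k}$ for some $n$ and $G_1$ as above ($n=1$ allowed) with the orders of the factors pairwise coprime, and \[ \gamma^{\text{strong}}(\mathcal{G}_E^{**}(G))=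 \begin{cases} 2^{k-1}+2, & \text{if } G\cong Q_{2^k}, \text{ or } G\cong\mathbb{Z}_n\times Q_{2^k} \text{ with } \gcd(n,2)=1,\\ \min\{r_1,\,2^{k-2}+1\}+1, & \text{if } G\cong G_1\times Q_{2^k} \text{ with } \gcd(|G_1|,2)=1, \text{ or}\\ & G\cong G_1\times\mathbb{Z}_n\times Q_{2^k} \text{ with } \gcd(|G_1|,n)=\gcd(|G_1|,2)=\gcd(n,2)=1. \end{cases} \] -/

import Mathlib

universe u v

namespace EnhancedPower

/-- The enhanced power graph of a group: distinct `x`, `y` are adjacent iff both lie in a common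
cyclic subgroup `⟨w⟩`. -/
def enhancedPowerGraph (G : Type u) [Group G] : SimpleGraph G where
  Adj x y := x ≠ y ∧ ∃ w : G, x ∈ Subgroup.zpowers w ∧ y ∈ Subgroup.zpowers w
  symm := ⟨fun _ _ h => ⟨h.1.symm, h.2.imp fun _ hw => ⟨hw.2, hw.1⟩⟩⟩
  loopless := ⟨fun _ h => h.1 rfl⟩

/-- A dominating vertex is adjacent to every other vertex. -/
def IsDominatingVertex {V : Type u} (Γ : SimpleGraph V) (x : V) : Prop :=
  ∀ y : V, y ≠ x → Γ.Adj x y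

/-- The proper enhanced power graph: all dominating vertices are deleted. -/
def properEnhancedPowerGraph (G : Type u) [Group G] :
    SimpleGraph {x : G | ¬ IsDominatingVertex (enhancedPowerGraph G) x} :=
  (enhancedPowerGraph G).induce {x : G | ¬ IsDominatingVertex (enhancedPowerGraph G) x}

/-- A strongly dominating (total dominating) set: every vertex of the graph, including those of
`D`, has a neighbour in `D`. -/
def IsStronglyDominating {V : Type u} (Γ : SimpleGraph V) (D : Set V) : Prop :=
  ∀ x : V, ∃ y ∈ D, Γ.Adj x y

/-- The least size of a finite strongly dominating set. The value `0` is taken only if the graph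
has no vertices or no finite strongly dominating set, so that a positive value is attained. -/
noncomputable def strongDominationNumber {V : Type u} (Γ : SimpleGraph V) : ℕ :=
  sInf {t : ℕ | ∃ D : Finset V, IsStronglyDominating Γ (D : Set V) ∧ D.card = t}

/-- The generalized quaternion group of order `2 ^ k`, for `k ≥ 3`
(`QuaternionGroup m` has order `4 * m`). -/
abbrev GenQuaternion (k : ℕ) : Type := QuaternionGroup (2 ^ (k - 2))

/-- `G` is a generalized quaternion group `Q_{2^k}`, `k ≥ 3`. -/
def IsGenQuaternion (G : Type u) [Group G] : Prop :=
  ∃ k : ℕ, 3 ≤ k ∧ Nonempty (G ≃* GenQuaternion k)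

/-- A nontrivial finite nilpotent group none of whose (nontrivial) Sylow subgroups is cyclic or
generalized quaternion. -/
structure IsNoncyclicPart (G₁ : Type u) [Group G₁] : Prop where
  finite : Finite G₁
  nontrivial : Nontrivial G₁
  nilpotent : Group.IsNilpotent G₁
  sylow : ∀ p : ℕ, p.Prime → p ∣ Nat.card G₁ → ∀ P : Sylow p G₁,
    ¬ IsCyclic P ∧ ¬ IsGenQuaternion P

/-- The number of subgroups of order `q`. -/
noncomputable def numSubgroups (G : Type u) [Group G] (q : ℕ) : ℕ :=
  Nat.card {H : Subgroup G // Nat.card H = q}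

/-- The least, over the primes `p` dividing `|G₁|`, of the number of subgroups of order `p`
of a Sylow `p`-subgroup of `G₁`. -/
noncomputable def minNumPrimeSubgroups (G₁ : Type u) [Group G₁] : ℕ :=
  sInf {r : ℕ | ∃ p : ℕ, p.Prime ∧ p ∣ Nat.card G₁ ∧ ∃ P : Sylow p G₁, r = numSubgroups P p}

end EnhancedPower

/-!
Call `x`, `y` a cyclic pair if both lie in a cyclic subgroup. The dominating vertices of the
enhanced power graph form the cyclicizer: the elements which are in a cyclic pair with every
element. In `T = ℤ_n × Q_{2^k}`, being a cyclic pair is an equivalence relation outside the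
cyclicizer, whose classes correspond to the `m + 1` maximal cyclic subgroups of `Q_{2^k}`, where
`m = 2 ^ (k - 2)`. So the graph of `T` is a disjoint union of `m + 1` cliques, and a strongly
dominating set needs two vertices of each.

With a further factor `G₁` of odd order, cyclic pairs in `G₁ × T` are those in both components. A
small strongly dominating set consists of one vertex `(1, t)` together with generators `(z, 1)` of
all subgroups of order `p`, or of one vertex `(z, 1)` together with one `(1, t)` for every class of
`T`. Here `(z, 1)` is not dominating because a `p`-group with a unique subgroup of order `p` is
cyclic for odd `p`. Conversely, let `D` be strongly dominating and let `d, d' ∈ D` be adjacent. Then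
`d` and `d'` see at most one class of `T` between them, and for each prime `q` at most one subgroup
of order `q`. If `D` had at most `min r₁ (m + 1)` elements, it would therefore miss a class and, for
every `q`, a subgroup of order `q`. A vertex `(g, t)` with `t` in the missed class, and with `g`
generating the product of the missed subgroups, then has no neighbour in `D`.
-/

namespace EnhancedPower

section StrongDomination

variable {V : Type u} {Γ : SimpleGraph V}

theorem strongDominationNumber_eq_of_forall_le {N : ℕ}
    (hle : ∃ D : Finset V, IsStronglyDominating Γ (D : Set V) ∧ D.card ≤ N)
    (hge : ∀ D : Finset V, IsStronglyDominating Γ (D : Set V) → N ≤ D.card) :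
    strongDominationNumber Γ = N := by
  obtain ⟨D, hD, hDN⟩ := hle
  refine le_antisymm (le_trans (Nat.sInf_le ⟨D, hD, rfl⟩) hDN) ?_
  refine le_csInf ⟨D.card, D, hD, rfl⟩ ?_
  rintro _ ⟨D', hD', rfl⟩
  exact hge D' hD'

theorem IsStronglyDominating.map_iso {W : Type v} {Δ : SimpleGraph W} {D : Finset V}
    (hD : IsStronglyDominating Γ (D : Set V)) (e : Γ ≃g Δ) :
    IsStronglyDominating Δ (D.map e.toEquiv.toEmbedding : Finset W) := by
  intro y
  obtain ⟨x, hxD, hadj⟩ := hD (e.symm y)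
  exact ⟨e x, by simpa using hxD, by simpa using e.map_adj_iff.mpr hadj⟩

theorem strongDominationNumber_congr {W : Type v} {Δ : SimpleGraph W} (e : Γ ≃g Δ) :
    strongDominationNumber Γ = strongDominationNumber Δ := by
  refine congrArg sInf (Set.ext fun t => ⟨?_, ?_⟩)
  · rintro ⟨D, hD, rfl⟩
    exact ⟨_, hD.map_iso e, Finset.card_map _⟩
  · rintro ⟨D, hD, rfl⟩
    exact ⟨_, hD.map_iso e.symm, Finset.card_map _⟩

theorem strongDominationNumber_of_adj_iff {ι : Type*} [Fintype ι] (f : V → ι)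
    (hadj : ∀ x y, Γ.Adj x y ↔ x ≠ y ∧ f x = f y)
    (hf : ∀ i, ∃ x y, x ≠ y ∧ f x = i ∧ f y = i) :
    strongDominationNumber Γ = 2 * Fintype.card ι := by
  classical
  choose x y hxy hx hy using hf
  refine strongDominationNumber_eq_of_forall_le
    ⟨Finset.univ.image x ∪ Finset.univ.image y, fun v => ?_, ?_⟩ fun D hD => ?_
  · by_cases hv : v = x (f v)
    · exact ⟨y (f v), by simp, (hadj _ _).mpr ⟨fun h => hxy (f v) (hv.symm.trans h), (hy _).symm⟩⟩
    · exact ⟨x (f v), by simp, (hadj _ _).mpr ⟨hv, (hx _).symm⟩⟩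
  · calc _ ≤ (Finset.univ.image x).card + (Finset.univ.image y).card := Finset.card_union_le _ _
      _ ≤ Fintype.card ι + Fintype.card ι := add_le_add Finset.card_image_le Finset.card_image_le
      _ = 2 * Fintype.card ι := (two_mul _).symm
  · have one_lt_card_fiber (i : ι) : 1 < (D.filter (f · = i)).card := by
      obtain ⟨d, hd, hxd⟩ := hD (x i)
      obtain ⟨d', hd', hdd'⟩ := hD d
      have hdi : f d = i := ((hadj _ _).mp hxd).2.symm.trans (hx i)
      have hdi' : f d' = i := ((hadj _ _).mp hdd').2.symm.trans hdi
      exact Finset.one_lt_card.mpr ⟨d, Finset.mem_filter.mpr ⟨hd, hdi⟩, d',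
        Finset.mem_filter.mpr ⟨hd', hdi'⟩, hdd'.ne⟩
    exact Finset.mul_card_image_le_card_of_maps_to (fun d _ => Finset.mem_univ (f d)) 2
      fun i _ => one_lt_card_fiber i

theorem exists_forall_not_rel_of_card_le {α ι : Type*} {R : α → ι → Prop}
    (hR : ∀ d i j, R d i → R d j → i = j) {D : Finset α} {d d' : α} (hd : d ∈ D) (hd' : d' ∈ D)
    (hne : d ≠ d') (hdd' : ∀ i j, R d i → R d' j → i = j) (hD : D.card ≤ Nat.card ι) :
    ∃ i, ∀ e ∈ D, ¬ R e i := by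
  by_contra! h
  choose g hgD hgR using h
  have g_injective : Function.Injective g := fun i j hij => hR _ _ _ (hgR i) (hij ▸ hgR j)
  have g_bijective : Function.Bijective fun i => (⟨g i, hgD i⟩ : D) := by
    refine Function.Injective.bijective_of_nat_card_le
      (fun i j hij => g_injective (congrArg Subtype.val hij)) ?_
    rwa [Nat.card_eq_fintype_card, Fintype.card_coe]
  obtain ⟨i, hi⟩ := g_bijective.surjective ⟨d, hd⟩
  obtain ⟨j, hj⟩ := g_bijective.surjective ⟨d', hd'⟩
  obtain rfl : g i = d := congrArg Subtype.val hi
  obtain rfl : g j = d' := congrArg Subtype.val hj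
  exact hne (congrArg g (hdd' i j (hgR i) (hgR j)))

end StrongDomination

section CyclicPair

variable {G H : Type*} [Group G] [Group H]

/-- Two elements lying in a common cyclic subgroup, that is, being equal or adjacent in the enhanced
power graph. -/
def CyclicPair (x y : G) : Prop :=
  ∃ w : G, x ∈ Subgroup.zpowers w ∧ y ∈ Subgroup.zpowers w

variable (G) in
/-- The cyclicizer of a group: the elements forming a cyclic pair with every element. They turn out
to be the dominating vertices of the enhanced power graph. -/
def cyclicizer : Set G := {x | ∀ y, CyclicPair x y}

namespace CyclicPair

variable {x y : G}

theorem symm (h : CyclicPair x y) : CyclicPair y x := h.imp fun _ hw => hw.symm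

theorem of_mem_zpowers (h : x ∈ Subgroup.zpowers y) : CyclicPair x y :=
  ⟨y, h, Subgroup.mem_zpowers y⟩

theorem rfl : CyclicPair x x := of_mem_zpowers (Subgroup.mem_zpowers x)

theorem of_isCyclic [IsCyclic G] (x y : G) : CyclicPair x y :=
  (IsCyclic.exists_generator (α := G)).imp fun _ hw => ⟨hw x, hw y⟩

theorem commute (h : CyclicPair x y) : Commute x y := by
  obtain ⟨w, ⟨i, rfl⟩, ⟨j, rfl⟩⟩ := h
  exact (Commute.refl w).zpow_zpow i j

theorem map (h : CyclicPair x y) (f : G →* H) : CyclicPair (f x) (f y) := by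
  obtain ⟨w, hx, hy⟩ := h
  refine ⟨f w, ?_, ?_⟩ <;> rw [← MonoidHom.map_zpowers]
  exacts [Subgroup.mem_map_of_mem f hx, Subgroup.mem_map_of_mem f hy]

theorem map_mulEquiv_iff (e : G ≃* H) : CyclicPair (e x) (e y) ↔ CyclicPair x y :=
  ⟨fun h => by simpa using h.map e.symm.toMonoidHom, fun h => h.map e.toMonoidHom⟩

theorem of_coprime (hxy : Commute x y) (h : (orderOf x).Coprime (orderOf y)) : CyclicPair x y := by
  have commute_subtype (m : Subgroup.zpowers x) (n : Subgroup.zpowers y) :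
      Commute ((Subgroup.zpowers x).subtype m) ((Subgroup.zpowers y).subtype n) := by
    obtain ⟨⟨_, i, rfl⟩, ⟨_, j, rfl⟩⟩ := m, n
    exact hxy.zpow_zpow i j
  have : IsCyclic (Subgroup.zpowers x × Subgroup.zpowers y) :=
    Group.isCyclic_prod_iff.mpr ⟨inferInstance, inferInstance, by simpa using h⟩
  have hpair := (of_isCyclic (⟨x, Subgroup.mem_zpowers x⟩, 1) (1, ⟨y, Subgroup.mem_zpowers y⟩)).map
    (MonoidHom.noncommCoprod _ _ commute_subtype)
  simpa [MonoidHom.noncommCoprod_apply] using hpair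

end CyclicPair

theorem cyclicPair_prod_iff (h : (Nat.card G).Coprime (Nat.card H)) {x y : G × H} :
    CyclicPair x y ↔ CyclicPair x.1 y.1 ∧ CyclicPair x.2 y.2 := by
  refine ⟨fun hxy => ⟨hxy.map (MonoidHom.fst G H), hxy.map (MonoidHom.snd G H)⟩, ?_⟩
  rintro ⟨⟨w, hx₁, hy₁⟩, ⟨z, hx₂, hy₂⟩⟩
  have : IsCyclic (Subgroup.zpowers w × Subgroup.zpowers z) := by
    refine Group.isCyclic_prod_iff.mpr ⟨inferInstance, inferInstance, ?_⟩
    exact (h.coprime_dvd_left (Subgroup.card_subgroup_dvd_card _)).coprime_dvd_right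
      (Subgroup.card_subgroup_dvd_card _)
  exact (CyclicPair.of_isCyclic (⟨x.1, hx₁⟩, ⟨x.2, hx₂⟩) (⟨y.1, hy₁⟩, ⟨y.2, hy₂⟩)).map
    ((Subgroup.zpowers w).subtype.prodMap (Subgroup.zpowers z).subtype)

theorem one_mem_cyclicizer : (1 : G) ∈ cyclicizer G :=
  fun y => CyclicPair.of_mem_zpowers (one_mem (Subgroup.zpowers y))

theorem inv_mem_cyclicizer {x : G} (hx : x ∈ cyclicizer G) : x⁻¹ ∈ cyclicizer G :=
  fun y => (hx y).imp fun _ hw => ⟨inv_mem hw.1, hw.2⟩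

theorem mem_cyclicizer_of_isCyclic [IsCyclic G] (x : G) : x ∈ cyclicizer G :=
  CyclicPair.of_isCyclic x

theorem mem_cyclicizer_prod_iff (h : (Nat.card G).Coprime (Nat.card H)) {x : G × H} :
    x ∈ cyclicizer (G × H) ↔ x.1 ∈ cyclicizer G ∧ x.2 ∈ cyclicizer H := by
  refine ⟨fun hx => ⟨fun y => ((cyclicPair_prod_iff h).mp (hx (y, 1))).1,
    fun y => ((cyclicPair_prod_iff h).mp (hx (1, y))).2⟩, fun hx y => ?_⟩
  exact (cyclicPair_prod_iff h).mpr ⟨hx.1 y.1, hx.2 y.2⟩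

theorem map_mem_cyclicizer_iff (e : G ≃* H) {x : G} : e x ∈ cyclicizer H ↔ x ∈ cyclicizer G :=
  ⟨fun h y => (CyclicPair.map_mulEquiv_iff e).mp (h (e y)), fun h y => by
    simpa using (CyclicPair.map_mulEquiv_iff e).mpr (h (e.symm y))⟩

theorem eq_of_card_eq_of_isCyclic {L : Type*} [Group L] [Finite L] [IsCyclic L]
    {K K' : Subgroup L} (h : Nat.card K = Nat.card K') : K = K' := by
  let _ : CommGroup L := IsCyclic.commGroup
  have eq_ker (M : Subgroup L) : M = (powMonoidHom (Nat.card M) : L →* L).ker := by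
    refine Subgroup.eq_of_le_of_card_ge (fun m hm => ?_) ?_
    · exact congrArg Subtype.val (pow_card_eq_one' (x := (⟨m, hm⟩ : M)))
    · rw [IsCyclic.card_powMonoidHom_ker, Nat.gcd_eq_right (Subgroup.card_subgroup_dvd_card M)]
  rw [eq_ker K, eq_ker K', h]

theorem CyclicPair.eq_of_card_eq [Finite G] {x y : G} (h : CyclicPair x y) {K K' : Subgroup G}
    (hK : K ≤ Subgroup.zpowers x) (hK' : K' ≤ Subgroup.zpowers y)
    (hcard : Nat.card K = Nat.card K') : K = K' := by
  obtain ⟨w, hx, hy⟩ := h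
  have hKw := hK.trans (Subgroup.zpowers_le.mpr hx)
  have hKw' := hK'.trans (Subgroup.zpowers_le.mpr hy)
  have hsub : K.subgroupOf (Subgroup.zpowers w) = K'.subgroupOf (Subgroup.zpowers w) := by
    refine eq_of_card_eq_of_isCyclic ?_
    rw [Nat.card_congr (Subgroup.subgroupOfEquivOfLe hKw).toEquiv, hcard,
      Nat.card_congr (Subgroup.subgroupOfEquivOfLe hKw').toEquiv]
  rwa [Subgroup.subgroupOf_inj, inf_of_le_left hKw, inf_of_le_left hKw'] at hsub

end CyclicPair

section ProperEnhancedPowerGraph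

variable {G : Type u} {H : Type v} [Group G] [Group H]

theorem isDominatingVertex_enhancedPowerGraph_iff {x : G} :
    IsDominatingVertex (enhancedPowerGraph G) x ↔ x ∈ cyclicizer G := by
  refine ⟨fun h y => ?_, fun h y hy => ⟨hy.symm, h y⟩⟩
  obtain rfl | hy := eq_or_ne y x
  exacts [CyclicPair.rfl, (h y hy).2]

theorem properEnhancedPowerGraph_adj_iff
    {x y : {x : G | ¬ IsDominatingVertex (enhancedPowerGraph G) x}} :
    (properEnhancedPowerGraph G).Adj x y ↔ x ≠ y ∧ CyclicPair (x : G) y :=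
  and_congr_left' (not_congr Subtype.ext_iff.symm)

/-- Isomorphic groups have isomorphic proper enhanced power graphs. -/
def properEnhancedPowerGraphIso (e : G ≃* H) :
    properEnhancedPowerGraph G ≃g properEnhancedPowerGraph H where
  toEquiv := e.toEquiv.subtypeEquiv fun x => not_congr <| by
    rw [isDominatingVertex_enhancedPowerGraph_iff, isDominatingVertex_enhancedPowerGraph_iff]
    exact (map_mem_cyclicizer_iff e).symm
  map_rel_iff' {x y} := by
    rw [properEnhancedPowerGraph_adj_iff, properEnhancedPowerGraph_adj_iff]
    exact and_congr (Equiv.apply_eq_iff_eq _).not (CyclicPair.map_mulEquiv_iff e)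

end ProperEnhancedPowerGraph

section PrimePowerMap

open scoped commutatorElement

variable {G : Type*} [Group G]

theorem commutatorElement_pow_left {x y : G} (h : ⁅y, x⁆ ∈ Subgroup.center G) (n : ℕ) :
    ⁅y ^ n, x⁆ = ⁅y, x⁆ ^ n := by
  induction n with
  | zero => simp
  | succ n ih =>
    rw [pow_succ', commutatorElement_mul_left_eq_conj_mul, ih, pow_succ,
      Subgroup.mem_center_iff.mp (pow_mem h n) y, mul_inv_cancel_right]

theorem mul_pow_of_commutatorElement_mem_center {x y : G} (h : ⁅y, x⁆ ∈ Subgroup.center G) (n : ℕ) :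
    (x * y) ^ n = x ^ n * y ^ n * ⁅y, x⁆ ^ n.choose 2 := by
  induction n with
  | zero => simp
  | succ n ih =>
    have comm (k : ℕ) (g : G) : g * ⁅y, x⁆ ^ k = ⁅y, x⁆ ^ k * g :=
      Subgroup.mem_center_iff.mp (pow_mem h k) g
    have swap : y ^ n * x = x * y ^ n * ⁅y, x⁆ ^ n := by
      rw [comm, ← commutatorElement_pow_left h, commutatorElement_def]
      group
    calc (x * y) ^ (n + 1) = x ^ n * y ^ n * ⁅y, x⁆ ^ n.choose 2 * (x * y) := by rw [pow_succ, ih]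
      _ = x ^ n * (y ^ n * x) * y * ⁅y, x⁆ ^ n.choose 2 := by
        rw [mul_assoc, ← comm]; simp only [mul_assoc]
      _ = x ^ (n + 1) * y ^ (n + 1) * (⁅y, x⁆ ^ n * ⁅y, x⁆ ^ n.choose 2) := by
        rw [swap, pow_succ x, pow_succ y]
        simp only [mul_assoc]
        rw [← mul_assoc (⁅y, x⁆ ^ n) y, ← comm, mul_assoc]
      _ = x ^ (n + 1) * y ^ (n + 1) * ⁅y, x⁆ ^ (n + 1).choose 2 := by
        rw [← pow_add, Nat.choose_succ_succ' n 1, Nat.choose_one_right]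

theorem mul_pow_prime_of_commutatorElement_mem_center {p : ℕ} (hp : p.Prime) (hp2 : p ≠ 2) {x y : G}
    (h : ⁅y, x⁆ ∈ Subgroup.center G) (hpow : ⁅y, x⁆ ^ p = 1) : (x * y) ^ p = x ^ p * y ^ p := by
  obtain ⟨k, hk⟩ := hp.dvd_choose_self two_ne_zero (hp.two_le.lt_of_ne' hp2)
  rw [mul_pow_of_commutatorElement_mem_center h, hk, pow_mul, hpow, one_pow, mul_one]

variable {K M : Subgroup G}

theorem inf_le_center_of_sup_eq_top [IsMulCommutative K] [IsMulCommutative M] (h : K ⊔ M = ⊤) :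
    K ⊓ M ≤ Subgroup.center G := by
  have hK : K ≤ Subgroup.centralizer (K ⊓ M : Subgroup G) :=
    K.le_centralizer.trans (Subgroup.centralizer_le inf_le_left)
  have hM : M ≤ Subgroup.centralizer (K ⊓ M : Subgroup G) :=
    M.le_centralizer.trans (Subgroup.centralizer_le inf_le_right)
  exact Subgroup.centralizer_eq_top_iff_subset.mp (top_le_iff.mp (h ▸ sup_le hK hM))

theorem pow_mem_inf_of_index_eq {n : ℕ} [K.Normal] [M.Normal] (hK : K.index = n) (hM : M.index = n)
    (x : G) : x ^ n ∈ K ⊓ M :=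
  Subgroup.mem_inf.mpr
    ⟨by simpa only [hK] using K.pow_index_mem x, by simpa only [hM] using M.pow_index_mem x⟩

theorem eq_of_le_of_index_eq [K.FiniteIndex] (hle : K ≤ M) (h : K.index = M.index) : K = M :=
  hle.eq_of_not_lt fun hlt => (Subgroup.index_strictAnti hlt).ne' h

theorem sup_eq_top_of_index_prime [K.FiniteIndex] [M.FiniteIndex] (hK : K.index.Prime)
    (hKM : K.index = M.index) (hne : K ≠ M) : K ⊔ M = ⊤ := by
  have index_sup : (K ⊔ M).index = 1 ∨ (K ⊔ M).index = K.index :=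
    (Nat.dvd_prime hK).mp (Subgroup.index_dvd_of_le le_sup_left)
  refine Subgroup.index_eq_one.mp (index_sup.resolve_right fun h => hne ?_)
  rw [eq_of_le_of_index_eq le_sup_left h.symm,
    ← eq_of_le_of_index_eq le_sup_right (hKM.symm.trans h.symm)]

variable {p : ℕ} [Fact p.Prime] [Finite G]

theorem mul_pow_of_index_prime (hp2 : p ≠ 2) [K.Normal] [M.Normal] [IsMulCommutative K]
    [IsMulCommutative M] (hK : K.index = p) (hM : M.index = p) (hne : K ≠ M) (x y : G) :
    (x * y) ^ p = x ^ p * y ^ p := by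
  have hp : p.Prime := Fact.out
  have htop : K ⊔ M = ⊤ := sup_eq_top_of_index_prime (hK ▸ hp) (hK.trans hM.symm) hne
  have hcenter : K ⊓ M ≤ Subgroup.center G := inf_le_center_of_sup_eq_top htop
  have commutator_le : commutator G ≤ K ⊓ M := le_inf
    (Subgroup.Normal.commutator_le_of_self_sup_commutative_eq_top htop inferInstance)
    (Subgroup.Normal.commutator_le_of_self_sup_commutative_eq_top (sup_comm K M ▸ htop)
      inferInstance)
  have commutatorElement_mem : ⁅y, x⁆ ∈ Subgroup.center G := hcenter
    (commutator_le (Subgroup.commutator_mem_commutator (Subgroup.mem_top y) (Subgroup.mem_top x)))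
  refine mul_pow_prime_of_commutatorElement_mem_center hp hp2 commutatorElement_mem ?_
  rw [← commutatorElement_pow_left commutatorElement_mem, commutatorElement_eq_one_iff_mul_comm]
  exact (Subgroup.mem_center_iff.mp (hcenter (pow_mem_inf_of_index_eq hK hM y)) x).symm

theorem exists_ne_card_eq_of_forall_pow_eq_one {N : Subgroup G} (hN : ∀ x ∈ N, x ^ p = 1)
    (hcard : p < Nat.card N) :
    ∃ H H' : Subgroup G, Nat.card H = p ∧ Nat.card H' = p ∧ H ≠ H' := by
  have card_zpowers {x : G} (hx : x ∈ N) (hx1 : x ≠ 1) : Nat.card (Subgroup.zpowers x) = p := by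
    rw [Nat.card_zpowers]
    exact orderOf_eq_prime (hN x hx) hx1
  have : Nontrivial N := Finite.one_lt_card_iff_nontrivial.mp
    ((Nat.Prime.one_lt Fact.out).trans hcard)
  obtain ⟨x, hx, hx1⟩ := N.exists_ne_one_of_nontrivial
  obtain ⟨y, hy, hyx⟩ : ∃ y ∈ N, y ∉ Subgroup.zpowers x := by
    by_contra! hle
    exact hcard.not_ge ((Subgroup.card_le_of_le hle).trans (card_zpowers hx hx1).le)
  have hy1 : y ≠ 1 := (ne_of_mem_of_not_mem (one_mem _) hyx).symm
  exact ⟨_, _, card_zpowers hx hx1, card_zpowers hy hy1,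
    fun h => hyx (h ▸ Subgroup.mem_zpowers y)⟩

/-- The `p`-th power map is an endomorphism with image in `K ⊓ M`, which has index greater than `p`;
hence more than `p` elements are killed by it. -/
theorem exists_ne_card_eq_of_index_prime (hp2 : p ≠ 2) [K.Normal] [M.Normal] [IsMulCommutative K]
    [IsMulCommutative M] (hK : K.index = p) (hM : M.index = p) (hne : K ≠ M) :
    ∃ H H' : Subgroup G, Nat.card H = p ∧ Nat.card H' = p ∧ H ≠ H' := by
  let φ : G →* G := MonoidHom.mk' (· ^ p) (mul_pow_of_index_prime hp2 hK hM hne)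
  refine exists_ne_card_eq_of_forall_pow_eq_one (N := φ.ker) (fun _ => id) ?_
  have range_le : φ.range ≤ K ⊓ M := by
    rintro _ ⟨x, rfl⟩
    exact pow_mem_inf_of_index_eq hK hM x
  have lt_index : p < (K ⊓ M).index := by
    rw [← hK]
    refine Subgroup.index_strictAnti (inf_le_left.lt_of_ne fun h => hne ?_)
    exact eq_of_le_of_index_eq (inf_eq_left.mp h) (hK.trans hM.symm)
  refine lt_index.trans_le (Nat.le_of_mul_le_mul_right ?_ (Nat.card_pos (α := φ.range)))
  calc (K ⊓ M).index * Nat.card φ.range ≤ (K ⊓ M).index * Nat.card (K ⊓ M : Subgroup G) :=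
        Nat.mul_le_mul_left _ (Subgroup.card_le_of_le range_le)
    _ = Nat.card G := (K ⊓ M).index_mul_card
    _ = Nat.card φ.ker * Nat.card φ.range := by rw [← Subgroup.index_ker, Subgroup.card_mul_index]

end PrimePowerMap

section UniqueSubgroupOfPrimeOrder

variable {p : ℕ} [Fact p.Prime]

theorem exists_index_eq_prime_ge {P : Type*} [Group P] [Finite P] (hP : IsPGroup p P)
    {L : Subgroup P} (hL : L ≠ ⊤) : ∃ K : Subgroup P, L ≤ K ∧ K.index = p ∧ K.Normal := by
  have hp : p.Prime := Fact.out
  obtain ⟨m, hm⟩ := IsPGroup.iff_card.mp (hP.to_subgroup L)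
  obtain ⟨n, hn⟩ := IsPGroup.iff_card.mp hP
  have hmn : m < n := by
    rw [← Nat.pow_lt_pow_iff_right hp.one_lt, ← hm, ← hn]
    exact (Subgroup.card_le_card_group L).lt_of_ne fun h => hL (Subgroup.eq_top_of_card_eq L h)
  obtain ⟨n, rfl⟩ : ∃ k, n = k + 1 := Nat.exists_eq_succ_of_ne_zero (by omega)
  obtain ⟨K, hK, hLK⟩ := Sylow.exists_subgroup_card_pow_prime_le p
    (hn ▸ pow_dvd_pow p n.le_succ) L hm (Nat.lt_succ_iff.mp hmn)
  have index_eq : K.index = p := by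
    have := K.card_mul_index
    rw [hK, hn, pow_succ] at this
    exact Nat.eq_of_mul_eq_mul_left (pow_pos hp.pos n) this
  refine ⟨K, hLK, index_eq, Subgroup.normal_of_index_eq_minFac_card ?_⟩
  rw [hn, hp.pow_minFac n.succ_ne_zero, index_eq]

/-- In a minimal counterexample all proper subgroups are cyclic, hence commutative. -/
theorem isCyclic_of_unique_subgroup_of_forall_lt {P : Type*} [Group P] [Finite P]
    (hP : IsPGroup p P) (hp2 : p ≠ 2)
    (h : ∀ H H' : Subgroup P, Nat.card H = p → Nat.card H' = p → H = H')
    (ih : ∀ L : Subgroup P, L ≠ ⊤ → IsCyclic L) : IsCyclic P := by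
  by_contra hnc
  have zpowers_ne_top (x : P) : Subgroup.zpowers x ≠ ⊤ := fun hx =>
    hnc ⟨x, Subgroup.eq_top_iff' _ |>.mp hx⟩
  have proper {L : Subgroup P} (hL : L.index = p) : L ≠ ⊤ := by
    rintro rfl
    exact (Nat.Prime.one_lt Fact.out).ne (Subgroup.index_top.symm.trans hL)
  obtain ⟨K, -, hK, _⟩ := exists_index_eq_prime_ge hP (zpowers_ne_top 1)
  obtain ⟨x, hx⟩ : ∃ x, x ∉ K := by
    by_contra! hall
    exact proper hK ((Subgroup.eq_top_iff' K).mpr hall)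
  obtain ⟨M, hxM, hM, _⟩ := exists_index_eq_prime_ge hP (zpowers_ne_top x)
  have hne : K ≠ M := ne_of_mem_of_not_mem' (hxM (Subgroup.mem_zpowers x)) hx |>.symm
  have := ih K (proper hK)
  have := ih M (proper hM)
  obtain ⟨H, H', hH, hH', hHH'⟩ := exists_ne_card_eq_of_index_prime hp2 hK hM hne
  exact hHH' (h H H' hH hH')

theorem isCyclic_of_unique_subgroup_card_eq_prime {P : Type*} [Group P] [Finite P]
    (hP : IsPGroup p P) (hp2 : p ≠ 2)
    (h : ∀ H H' : Subgroup P, Nat.card H = p → Nat.card H' = p → H = H') : IsCyclic P := by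
  have isCyclic_subgroup (L : Subgroup P) : IsCyclic L := by
    induction L using WellFoundedLT.induction with
    | ind L ih =>
      have card_map (H : Subgroup L) : Nat.card (H.map L.subtype) = Nat.card H :=
        Subgroup.card_map_of_injective L.subtype_injective
      refine isCyclic_of_unique_subgroup_of_forall_lt (hP.to_subgroup L) hp2
        (fun H H' hH hH' => Subgroup.map_injective L.subtype_injective
          (h _ _ (by rw [card_map, hH]) (by rw [card_map, hH']))) fun M hM => ?_
      have : IsCyclic (M.map L.subtype) := ih _ ((Subgroup.map_subtype_le M).lt_of_ne fun hML => hM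
        (Subgroup.map_injective L.subtype_injective
          (by rw [hML, ← MonoidHom.range_eq_map, Subgroup.range_subtype])))
      exact (M.equivMapOfInjective _ L.subtype_injective).isCyclic.mpr this
  exact Subgroup.topEquiv.isCyclic.mp (isCyclic_subgroup ⊤)

theorem isCyclic_sylow_of_mem_cyclicizer {G : Type*} [Group G] [Finite G] (hp2 : p ≠ 2) {z : G}
    (hz : z ∈ cyclicizer G) (hzp : orderOf z = p) (P : Sylow p G) : IsCyclic P := by
  have eq_zpowers {H : Subgroup G} (hH : Nat.card H = p) : H = Subgroup.zpowers z := by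
    have := isCyclic_of_prime_card hH
    obtain ⟨h, rfl⟩ := H.isCyclic_iff_exists_zpowers_eq_top.mp this
    exact (hz h).symm.eq_of_card_eq le_rfl le_rfl (by rw [hH, Nat.card_zpowers, hzp])
  refine isCyclic_of_unique_subgroup_card_eq_prime P.isPGroup' hp2 fun H H' hH hH' => ?_
  have card_map (H : Subgroup P) : Nat.card (H.map P.1.subtype) = Nat.card H :=
    Subgroup.card_map_of_injective P.1.subtype_injective
  refine Subgroup.map_injective P.1.subtype_injective ?_
  rw [eq_zpowers ((card_map H).trans hH), eq_zpowers ((card_map H').trans hH')]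

end UniqueSubgroupOfPrimeOrder

section Nilpotent

theorem commute_of_coprime_orderOf_of_isPGroup {p : ℕ} [Fact p.Prime] {P : Type*} [Group P]
    (hP : IsPGroup p P) {x y : P} (h : (orderOf x).Coprime (orderOf y)) : Commute x y := by
  by_cases hx : x = 1
  · exact hx ▸ Commute.one_left y
  by_cases hy : y = 1
  · exact hy ▸ Commute.one_right x
  exact absurd h (Nat.not_coprime_of_dvd_of_dvd (Nat.Prime.one_lt Fact.out) (hP.dvd_orderOf hx)
    (hP.dvd_orderOf hy))

variable {G : Type u} [Group G] [Finite G] [Group.IsNilpotent G]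

theorem isPGroup_pi_sylow (p : ℕ) [Fact p.Prime] : IsPGroup p (∀ P : Sylow p G, P) := by
  have : Unique (Sylow p G) := Sylow.unique_of_normal default inferInstance
  exact (Sylow.isPGroup' _).of_equiv (MulEquiv.piUnique fun P : Sylow p G => P).symm

theorem commute_of_coprime_orderOf {x y : G} (h : (orderOf x).Coprime (orderOf y)) :
    Commute x y := by
  let e := Sylow.directProductOfNormal (G := G) fun P => inferInstance
  have commute_apply (p : (Nat.card G).primeFactors) : Commute (e.symm x p) (e.symm y p) := by
    have := Fact.mk (Nat.prime_of_mem_primeFactors p.2)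
    refine commute_of_coprime_orderOf_of_isPGroup (isPGroup_pi_sylow (G := G) p.1) ?_
    have orderOf_dvd (z : G) : orderOf (e.symm z p) ∣ orderOf z :=
      orderOf_map_dvd ((Pi.evalMonoidHom _ p).comp e.symm.toMonoidHom) z
    exact (h.coprime_dvd_left (orderOf_dvd x)).coprime_dvd_right (orderOf_dvd y)
  exact e.symm.injective (by simpa using (Pi.commute_iff.mpr commute_apply).eq)

theorem dvd_card_pi_sylow {ρ : (Nat.card G).primeFactors → Prop} {q : ℕ} (hq : q.Prime)
    (hdvd : q ∣ Nat.card (∀ p : {p // ρ p}, ∀ P : Sylow p.1 G, P)) : ∃ p, ρ p ∧ p.1 = q := by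
  classical
  rw [Nat.card_pi, hq.prime.dvd_finsetProd_iff] at hdvd
  obtain ⟨⟨p, hp⟩, -, hqp⟩ := hdvd
  have := Fact.mk (Nat.prime_of_mem_primeFactors p.2)
  obtain ⟨n, hn⟩ := IsPGroup.iff_card.mp (isPGroup_pi_sylow (G := G) p.1)
  exact ⟨p, hp, ((Nat.prime_dvd_prime_iff_eq hq Fact.out).mp
    (hq.dvd_of_dvd_pow (hn ▸ hqp))).symm⟩

variable (G) in
theorem exists_mulEquiv_prod (π : ℕ → Prop) : ∃ A B : Subgroup G,
    (∀ p : ℕ, p.Prime → p ∣ Nat.card A → π p) ∧ (∀ p : ℕ, p.Prime → p ∣ Nat.card B → ¬ π p) ∧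
      Nonempty (G ≃* A × B) := by
  classical
  let X (p : (Nat.card G).primeFactors) : Type u := ∀ P : Sylow p G, P
  let e : G ≃* (∀ p : {p : (Nat.card G).primeFactors // π p}, X p) ×
      (∀ p : {p : (Nat.card G).primeFactors // ¬ π p}, X p) :=
    (Sylow.directProductOfNormal fun P => inferInstance).symm.trans
      { Equiv.piEquivPiSubtypeProd (fun p : (Nat.card G).primeFactors => π p) X with
        map_mul' := fun _ _ => rfl }
  let α := MonoidHom.ofInjective (f := e.symm.toMonoidHom.comp (MonoidHom.inl _ _))
    (e.symm.injective.comp (Prod.mk_left_injective 1))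
  let β := MonoidHom.ofInjective (f := e.symm.toMonoidHom.comp (MonoidHom.inr _ _))
    (e.symm.injective.comp (Prod.mk_right_injective 1))
  refine ⟨_, _, fun q hq hdvd => ?_, fun q hq hdvd => ?_, ⟨e.trans (α.prodCongr β)⟩⟩
  · rw [Nat.card_congr α.symm.toEquiv] at hdvd
    obtain ⟨p, hp, rfl⟩ := dvd_card_pi_sylow hq hdvd
    exact hp
  · rw [Nat.card_congr β.symm.toEquiv] at hdvd
    obtain ⟨p, hp, rfl⟩ := dvd_card_pi_sylow hq hdvd
    exact hp

theorem isCyclic_pi_of_pairwise_coprime {ι : Type*} [Finite ι] {A : ι → Type*} [∀ i, Group (A i)]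
    [∀ i, Finite (A i)] [∀ i, IsCyclic (A i)]
    (h : Pairwise fun i j => (Nat.card (A i)).Coprime (Nat.card (A j))) :
    IsCyclic (∀ i, A i) := by
  have := Fintype.ofFinite ι
  choose g hg using fun i => isCyclic_iff_exists_zpowers_eq_top.mp (inferInstance : IsCyclic (A i))
  have orderOf_g (i : ι) : orderOf (g i) = Nat.card (A i) :=
    orderOf_eq_card_of_zpowers_eq_top (hg i)
  refine isCyclic_of_orderOf_eq_card g ?_
  simp only [Pi.orderOf, orderOf_g, Nat.card_pi]
  exact Finset.lcm_eq_prod fun i _ j _ hij => h hij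

theorem exists_forall_le_zpowers {ι : Type*} [Finite ι] {H : ι → Subgroup G}
    (hH : ∀ i, IsCyclic (H i))
    (h : Pairwise fun i j => (Nat.card (H i)).Coprime (Nat.card (H j))) :
    ∃ g : G, ∀ i, H i ≤ Subgroup.zpowers g := by
  have := Fintype.ofFinite ι
  have commute_of_ne : Pairwise fun i j => ∀ x y : G, x ∈ H i → y ∈ H j → Commute x y :=
    fun i j hij x y hx hy => commute_of_coprime_orderOf <|
      ((h hij).coprime_dvd_left ((H i).orderOf_dvd_natCard hx)).coprime_dvd_right
        ((H j).orderOf_dvd_natCard hy)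
  have := isCyclic_pi_of_pairwise_coprime h
  obtain ⟨g, hg⟩ := isCyclic_iff_exists_zpowers_eq_top.mp this
  refine ⟨Subgroup.noncommPiCoprod commute_of_ne g, fun i => ?_⟩
  rw [← MonoidHom.map_zpowers, hg, ← MonoidHom.range_eq_map, Subgroup.noncommPiCoprod_range]
  exact le_iSup H i

theorem numSubgroups_sylow {p : ℕ} [hp : Fact p.Prime] (P : Sylow p G) :
    numSubgroups P p = numSubgroups G p := by
  have := Sylow.unique_of_normal P inferInstance
  have le_sylow {H : Subgroup G} (hH : Nat.card H = p) : H ≤ P := by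
    have isPGroup_H : IsPGroup p H := IsPGroup.of_card (n := 1) (by rw [hH, pow_one])
    obtain ⟨Q, hQ⟩ := isPGroup_H.exists_le_sylow
    rwa [Subsingleton.elim P Q]
  let e : {H : Subgroup P // Nat.card H = p} ≃
      {H : {H : Subgroup G // H ≤ P} // Nat.card H.1 = p} :=
    (Subgroup.MapSubtype.orderIso (P : Subgroup G)).toEquiv.subtypeEquiv fun H => by
      rw [Nat.card_congr (H.equivMapOfInjective _ (P : Subgroup G).subtype_injective).toEquiv]
      rfl
  exact Nat.card_congr (e.trans (Equiv.subtypeSubtypeEquivSubtype le_sylow))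

theorem minNumPrimeSubgroups_le {p : ℕ} (hp : p.Prime) (hpG : p ∣ Nat.card G) :
    minNumPrimeSubgroups G ≤ numSubgroups G p :=
  have := Fact.mk hp
  Nat.sInf_le ⟨p, hp, hpG, default, (numSubgroups_sylow default).symm⟩

theorem exists_minNumPrimeSubgroups_eq [Nontrivial G] :
    ∃ p : ℕ, p.Prime ∧ p ∣ Nat.card G ∧ minNumPrimeSubgroups G = numSubgroups G p := by
  obtain ⟨q, hq, hqG⟩ := Nat.exists_prime_and_dvd (Finite.one_lt_card (α := G)).ne'
  obtain ⟨p, hp, hpG, P, hP⟩ := Nat.sInf_mem (s := {r : ℕ | ∃ p : ℕ, p.Prime ∧ p ∣ Nat.card G ∧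
    ∃ P : Sylow p G, r = numSubgroups P p}) ⟨_, q, hq, hqG, default, rfl⟩
  have := Fact.mk hp
  exact ⟨p, hp, hpG, hP.trans (numSubgroups_sylow P)⟩

end Nilpotent

section CyclicLabelling

/-- A labelling of the maximal cyclic subgroups of `T`, for a group in which being a cyclic pair is
an equivalence relation outside the cyclicizer: there, two elements have the same label if and only
if they form a cyclic pair. Labels of elements of the cyclicizer are junk. -/
structure IsCyclicLabelling {T ι : Type*} [Group T] (f : T → ι) : Prop where
  cyclicPair_iff {x y : T} : x ∉ cyclicizer T → y ∉ cyclicizer T → (CyclicPair x y ↔ f x = f y)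
  exists_apply_eq (i : ι) : ∃ x ∉ cyclicizer T, f x = i

namespace IsCyclicLabelling

variable {T : Type u} {ι : Type*} [Group T] {f : T → ι}

theorem comp_snd {C : Type*} [Group C] [IsCyclic C] (hf : IsCyclicLabelling f)
    (h : (Nat.card C).Coprime (Nat.card T)) : IsCyclicLabelling fun x : C × T => f x.2 where
  cyclicPair_iff {x y} hx hy := by
    rw [mem_cyclicizer_prod_iff h, and_iff_right (mem_cyclicizer_of_isCyclic _)] at hx hy
    rw [cyclicPair_prod_iff h, and_iff_right (CyclicPair.of_isCyclic _ _), hf.cyclicPair_iff hx hy]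
  exists_apply_eq i := by
    obtain ⟨x, hx, rfl⟩ := hf.exists_apply_eq i
    exact ⟨(1, x), fun h1x => hx ((mem_cyclicizer_prod_iff h).mp h1x).2, rfl⟩

theorem strongDominationNumber_eq [Fintype ι] (hf : IsCyclicLabelling f)
    (hinv : ∀ x ∉ cyclicizer T, x⁻¹ ≠ x) :
    strongDominationNumber (properEnhancedPowerGraph T) = 2 * Fintype.card ι := by
  have not_mem_cyclicizer (v : {x : T | ¬ IsDominatingVertex (enhancedPowerGraph T) x}) :
      (v : T) ∉ cyclicizer T := mt isDominatingVertex_enhancedPowerGraph_iff.mpr v.2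
  refine strongDominationNumber_of_adj_iff (fun v => f v) (fun v w => ?_) fun i => ?_
  · rw [properEnhancedPowerGraph_adj_iff,
      hf.cyclicPair_iff (not_mem_cyclicizer v) (not_mem_cyclicizer w)]
  · obtain ⟨x, hx, rfl⟩ := hf.exists_apply_eq i
    have hpair : CyclicPair x⁻¹ x := .of_mem_zpowers (inv_mem (Subgroup.mem_zpowers x))
    have hx' : x⁻¹ ∉ cyclicizer T := fun h => hx (inv_inv x ▸ inv_mem_cyclicizer h)
    exact ⟨⟨x⁻¹, mt isDominatingVertex_enhancedPowerGraph_iff.mp hx'⟩,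
      ⟨x, mt isDominatingVertex_enhancedPowerGraph_iff.mp hx⟩,
      fun h => hinv x hx (congrArg Subtype.val h), (hf.cyclicPair_iff hx' hx).mp hpair, rfl⟩

theorem exists_forall_apply_ne (hf : IsCyclicLabelling f) {α : Type*} (g : α → T)
    {D : Finset α} {d d' : α} (hd : d ∈ D) (hd' : d' ∈ D) (hne : d ≠ d')
    (hpair : CyclicPair (g d) (g d')) (hD : D.card ≤ Nat.card ι) :
    ∃ i, ∀ e ∈ D, g e ∉ cyclicizer T → f (g e) ≠ i := by
  obtain ⟨i, hi⟩ := exists_forall_not_rel_of_card_le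
    (R := fun e i => g e ∉ cyclicizer T ∧ f (g e) = i) (fun e i j hi hj => hi.2.symm.trans hj.2)
    hd hd' hne (fun i j hi hj => by rw [← hi.2, ← hj.2, ← hf.cyclicPair_iff hi.1 hj.1]; exact hpair)
    hD
  exact ⟨i, fun e he hge hei => hi e he ⟨hge, hei⟩⟩

end IsCyclicLabelling

end CyclicLabelling

section PrimeOrder

variable {G : Type*} [Group G] [Finite G]

theorem exists_mem_zpowers_orderOf_eq {x : G} {p : ℕ} (hp : p ∣ orderOf x) :
    ∃ z ∈ Subgroup.zpowers x, orderOf z = p :=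
  ⟨x ^ (orderOf x / p), pow_mem (Subgroup.mem_zpowers x) _,
    orderOf_pow_orderOf_div (orderOf_pos x).ne' hp⟩

theorem exists_card_eq_forall_not_le_zpowers {α : Type*} (g : α → G) {D : Finset α} {d d' : α}
    (hd : d ∈ D) (hd' : d' ∈ D) (hne : d ≠ d') (hpair : CyclicPair (g d) (g d')) {q : ℕ}
    (hD : D.card ≤ numSubgroups G q) :
    ∃ H : Subgroup G, Nat.card H = q ∧ ∀ e ∈ D, ¬ H ≤ Subgroup.zpowers (g e) := by
  obtain ⟨⟨H, hH⟩, hDH⟩ := exists_forall_not_rel_of_card_le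
    (R := fun e (H : {H : Subgroup G // Nat.card H = q}) => H.1 ≤ Subgroup.zpowers (g e))
    (fun e H K hH hK => Subtype.ext (CyclicPair.rfl.eq_of_card_eq hH hK (H.2.trans K.2.symm)))
    hd hd' hne
    (fun H K hH hK => Subtype.ext (hpair.eq_of_card_eq hH hK (H.2.trans K.2.symm))) hD
  exact ⟨H, hH, hDH⟩

variable [Group.IsNilpotent G]

theorem exists_orderOf_eq_cyclicPair {p : ℕ} (hp : p.Prime) (hpG : p ∣ Nat.card G) (x : G) :
    ∃ z, orderOf z = p ∧ CyclicPair x z := by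
  by_cases hpx : p ∣ orderOf x
  · obtain ⟨z, hzx, hz⟩ := exists_mem_zpowers_orderOf_eq hpx
    exact ⟨z, hz, (CyclicPair.of_mem_zpowers hzx).symm⟩
  · have := Fact.mk hp
    obtain ⟨z, hz⟩ := exists_prime_orderOf_dvd_card' p hpG
    have hxz : (orderOf x).Coprime (orderOf z) :=
      hz ▸ (Nat.coprime_comm.mp (hp.coprime_iff_not_dvd.mpr hpx))
    exact ⟨z, hz, .of_coprime (commute_of_coprime_orderOf hxz) hxz⟩

theorem exists_forall_cyclicPair_le_zpowers {K : ℕ → Subgroup G}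
    (hK : ∀ q, q.Prime → q ∣ Nat.card G → Nat.card (K q) = q) :
    ∃ g : G, ∀ x, x ≠ 1 → CyclicPair g x →
      ∃ q, q.Prime ∧ q ∣ Nat.card G ∧ K q ≤ Subgroup.zpowers x := by
  have card_K (q : (Nat.card G).primeFactors) : Nat.card (K q) = q :=
    hK q (Nat.prime_of_mem_primeFactors q.2) (Nat.dvd_of_mem_primeFactors q.2)
  have isCyclic_K (q : (Nat.card G).primeFactors) : IsCyclic (K q) :=
    have := Fact.mk (Nat.prime_of_mem_primeFactors q.2)
    isCyclic_of_prime_card (card_K q)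
  obtain ⟨g, hg⟩ := exists_forall_le_zpowers isCyclic_K fun q r hqr => by
    beta_reduce
    rw [card_K, card_K, Nat.coprime_primes (Nat.prime_of_mem_primeFactors q.2)
      (Nat.prime_of_mem_primeFactors r.2)]
    exact Subtype.coe_ne_coe.mpr hqr
  refine ⟨g, fun x hx hgx => ?_⟩
  obtain ⟨q, hq, hqx⟩ := Nat.exists_prime_and_dvd (mt orderOf_eq_one_iff.mp hx)
  have hqG : q ∣ Nat.card G := hqx.trans (orderOf_dvd_natCard x)
  obtain ⟨z, hzx, hz⟩ := exists_mem_zpowers_orderOf_eq hqx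
  have hKz : K q = Subgroup.zpowers z := hgx.eq_of_card_eq
    (hg ⟨q, Nat.mem_primeFactors.mpr ⟨hq, hqG, Nat.card_pos.ne'⟩⟩) (Subgroup.zpowers_le.mpr hzx)
    (by rw [hK q hq hqG, Nat.card_zpowers, hz])
  exact ⟨q, hq, hqG, hKz.le.trans (Subgroup.zpowers_le.mpr hzx)⟩

end PrimeOrder

section CoprimeProduct

theorem exists_isStronglyDominating_prod {A : Type u} {B : Type v} [Group A] [Group B]
    (h : (Nat.card A).Coprime (Nat.card B)) {ι : Type*} [Fintype ι] {a : ι → A}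
    (ha : ∀ i, a i ∉ cyclicizer A) (hpair : ∀ x, ∃ i, CyclicPair x (a i)) {b : B}
    (hb : b ∉ cyclicizer B) :
    ∃ D : Finset {x : A × B | ¬ IsDominatingVertex (enhancedPowerGraph (A × B)) x},
      IsStronglyDominating (properEnhancedPowerGraph (A × B)) (D : Set _) ∧
        D.card ≤ Fintype.card ι + 1 := by
  classical
  have not_dominating {x : A × B} (hx : ¬ (x.1 ∈ cyclicizer A ∧ x.2 ∈ cyclicizer B)) :
      ¬ IsDominatingVertex (enhancedPowerGraph (A × B)) x := by
    rwa [isDominatingVertex_enhancedPowerGraph_iff, mem_cyclicizer_prod_iff h]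
  let v (i : ι) : {x : A × B | ¬ IsDominatingVertex (enhancedPowerGraph (A × B)) x} :=
    ⟨(a i, 1), not_dominating fun hi => ha i hi.1⟩
  let w : {x : A × B | ¬ IsDominatingVertex (enhancedPowerGraph (A × B)) x} :=
    ⟨(1, b), not_dominating fun hi => hb hi.2⟩
  refine ⟨insert w (Finset.univ.image v), fun x => ?_,
    (Finset.card_insert_le _ _).trans (Nat.succ_le_succ Finset.card_image_le)⟩
  simp only [properEnhancedPowerGraph_adj_iff, cyclicPair_prod_iff h]
  obtain ⟨i, hi⟩ := hpair x.1.1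
  obtain rfl | hx := eq_or_ne x (v i)
  · refine ⟨w, by simp, fun hvw => ha i ?_, (one_mem_cyclicizer _).symm, one_mem_cyclicizer _⟩
    have a_eq_one : a i = 1 := congrArg (·.1.1) hvw
    exact a_eq_one ▸ one_mem_cyclicizer
  · exact ⟨v i, by simp, hx, hi, (one_mem_cyclicizer _).symm⟩

theorem IsCyclicLabelling.exists_isStronglyDominating_prod {A : Type u} {T : Type v} [Group A]
    [Group T] (h : (Nat.card A).Coprime (Nat.card T)) {ι : Type*} [Fintype ι] [Nonempty ι]
    {f : T → ι} (hf : IsCyclicLabelling f) {a : A} (ha : a ∉ cyclicizer A) :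
    ∃ D : Finset {x : A × T | ¬ IsDominatingVertex (enhancedPowerGraph (A × T)) x},
      IsStronglyDominating (properEnhancedPowerGraph (A × T)) (D : Set _) ∧
        D.card ≤ Fintype.card ι + 1 := by
  choose t ht hft using hf.exists_apply_eq
  have exists_cyclicPair (x : T) : ∃ i, CyclicPair x (t i) := by
    by_cases hx : x ∈ cyclicizer T
    · exact ⟨Classical.arbitrary ι, hx _⟩
    · exact ⟨f x, (hf.cyclicPair_iff hx (ht _)).mpr (hft _).symm⟩
  obtain ⟨D, hD, hcard⟩ :=
    EnhancedPower.exists_isStronglyDominating_prod h.symm ht exists_cyclicPair ha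
  exact ⟨_, hD.map_iso (properEnhancedPowerGraphIso MulEquiv.prodComm),
    (Finset.card_map _).trans_le hcard⟩

theorem exists_isStronglyDominating_prod_of_sylow {A : Type u} {B : Type v} [Group A] [Group B]
    [Finite A] [Group.IsNilpotent A] (h : (Nat.card A).Coprime (Nat.card B)) {p : ℕ}
    [hp : Fact p.Prime] (hp2 : p ≠ 2) (hpA : p ∣ Nat.card A) {P : Sylow p A} (hP : ¬ IsCyclic P)
    {b : B} (hb : b ∉ cyclicizer B) :
    ∃ D : Finset {x : A × B | ¬ IsDominatingVertex (enhancedPowerGraph (A × B)) x},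
      IsStronglyDominating (properEnhancedPowerGraph (A × B)) (D : Set _) ∧
        D.card ≤ numSubgroups A p + 1 := by
  have := Fintype.ofFinite {H : Subgroup A // Nat.card H = p}
  have exists_generator (H : {H : Subgroup A // Nat.card H = p}) :
      ∃ z : A, Subgroup.zpowers z = H :=
    H.1.isCyclic_iff_exists_zpowers_eq_top.mp (isCyclic_of_prime_card H.2)
  choose z hz using exists_generator
  have orderOf_z (H) : orderOf (z H) = p := by rw [← Nat.card_zpowers, hz, H.2]
  have exists_cyclicPair (x : A) : ∃ H, CyclicPair x (z H) := by
    obtain ⟨y, hy, w, hxw, hyw⟩ := exists_orderOf_eq_cyclicPair hp.out hpA x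
    let H : {H : Subgroup A // Nat.card H = p} := ⟨Subgroup.zpowers y, by rw [Nat.card_zpowers, hy]⟩
    have hzH : z H ∈ Subgroup.zpowers y := (hz H).le (Subgroup.mem_zpowers _)
    exact ⟨H, w, hxw, Subgroup.zpowers_le.mpr hyw hzH⟩
  rw [numSubgroups, Nat.card_eq_fintype_card]
  exact exists_isStronglyDominating_prod h
    (fun H hH => hP (isCyclic_sylow_of_mem_cyclicizer hp2 hH (orderOf_z H) P)) exists_cyclicPair hb

theorem IsCyclicLabelling.lt_card_of_isStronglyDominating_prod {A : Type u} {T : Type v} [Group A]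
    [Group T] [Finite A] [Group.IsNilpotent A] (h : (Nat.card A).Coprime (Nat.card T)) {ι : Type*}
    [Nonempty ι] {f : T → ι} (hf : IsCyclicLabelling f) {N : ℕ}
    (hA : ∀ q, q.Prime → q ∣ Nat.card A → N ≤ numSubgroups A q) (hι : N ≤ Nat.card ι)
    {D : Finset {x : A × T | ¬ IsDominatingVertex (enhancedPowerGraph (A × T)) x}}
    (hD : IsStronglyDominating (properEnhancedPowerGraph (A × T)) (D : Set _)) : N < D.card := by
  by_contra! hDN
  simp only [IsStronglyDominating, properEnhancedPowerGraph_adj_iff, cyclicPair_prod_iff h] at hD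
  have not_dominating {t : T} (ht : t ∉ cyclicizer T) (x : A) :
      ¬ IsDominatingVertex (enhancedPowerGraph (A × T)) (x, t) := by
    rw [isDominatingVertex_enhancedPowerGraph_iff, mem_cyclicizer_prod_iff h]
    exact fun hxt => ht hxt.2
  obtain ⟨t, ht, -⟩ := hf.exists_apply_eq (Classical.arbitrary ι)
  obtain ⟨d, hd, -⟩ := hD ⟨(1, t), not_dominating ht 1⟩
  obtain ⟨d', hd', hne, hpair⟩ := hD d
  obtain ⟨i, hi⟩ := hf.exists_forall_apply_ne (fun v : {x | _} => v.1.2) hd hd' hne hpair.2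
    (hDN.trans hι)
  have exists_subgroup (q : ℕ) (hq : q.Prime) (hqA : q ∣ Nat.card A) : ∃ K : Subgroup A,
      Nat.card K = q ∧ ∀ e ∈ D, ¬ K ≤ Subgroup.zpowers e.1.1 :=
    exists_card_eq_forall_not_le_zpowers (fun v : {x | _} => v.1.1) hd hd' hne hpair.1
      (hDN.trans (hA q hq hqA))
  choose! K hK using exists_subgroup
  obtain ⟨g, hg⟩ := exists_forall_cyclicPair_le_zpowers fun q hq hqA => (hK q hq hqA).1
  obtain ⟨x, hx, rfl⟩ := hf.exists_apply_eq i
  obtain ⟨e, he, -, hge, hxe⟩ := hD ⟨(g, x), not_dominating hx g⟩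
  have he₂ : e.1.2 ∈ cyclicizer T := by
    by_contra he₂
    exact hi e he he₂ ((hf.cyclicPair_iff hx he₂).mp hxe).symm
  have he₁ : e.1.1 ≠ 1 := fun he₁ => e.2 <| by
    rw [isDominatingVertex_enhancedPowerGraph_iff, mem_cyclicizer_prod_iff h, he₁]
    exact ⟨one_mem_cyclicizer, he₂⟩
  obtain ⟨q, hq, hqA, hKe⟩ := hg _ he₁ hge
  exact (hK q hq hqA).2 e he hKe

theorem IsCyclicLabelling.strongDominationNumber_prod {A T : Type*} [Group A]
    [Group T] (hA : IsNoncyclicPart A) (hA2 : (Nat.card A).Coprime 2)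
    (h : (Nat.card A).Coprime (Nat.card T)) {ι : Type*} [Fintype ι] [Nonempty ι] {f : T → ι}
    (hf : IsCyclicLabelling f) :
    strongDominationNumber (properEnhancedPowerGraph (A × T)) =
      min (minNumPrimeSubgroups A) (Fintype.card ι) + 1 := by
  have := hA.finite
  have := hA.nontrivial
  have := hA.nilpotent
  obtain ⟨p, hp, hpA, hmin⟩ := exists_minNumPrimeSubgroups_eq (G := A)
  have hp2 : p ≠ 2 := by
    rintro rfl
    exact Nat.not_coprime_of_dvd_of_dvd one_lt_two hpA dvd_rfl hA2
  have := Fact.mk hp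
  have hP := (hA.sylow p hp hpA default).1
  refine strongDominationNumber_eq_of_forall_le ?_ fun D hD =>
    hf.lt_card_of_isStronglyDominating_prod h
      (fun q hq hqA => (min_le_left _ _).trans (minNumPrimeSubgroups_le hq hqA))
      ((min_le_right _ _).trans_eq Nat.card_eq_fintype_card.symm) hD
  obtain hle | hle := le_total (minNumPrimeSubgroups A) (Fintype.card ι)
  · obtain ⟨t, ht, -⟩ := hf.exists_apply_eq (Classical.arbitrary ι)
    rw [min_eq_left hle, hmin]
    exact exists_isStronglyDominating_prod_of_sylow h hp2 hpA hP ht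
  · obtain ⟨z, hz⟩ := exists_prime_orderOf_dvd_card' p hpA
    rw [min_eq_right hle]
    exact hf.exists_isStronglyDominating_prod h fun hz' =>
      hP (isCyclic_sylow_of_mem_cyclicizer hp2 hz' hz _)

end CoprimeProduct

section Quaternion

open QuaternionGroup

variable {m : ℕ}

/-- The maximal cyclic subgroup containing a noncentral element of `QuaternionGroup m`: `none`
stands for `⟨a 1⟩`, and `some i` for `⟨xa i⟩ = {a 0, a m, xa i, xa (i + m)}`. -/
def maxCyclicIndex : QuaternionGroup m → Option (ZMod m)
  | a _ => none
  | xa i => some (ZMod.castHom (dvd_mul_left m 2) (ZMod m) i)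

theorem castHom_eq_castHom_iff {i j : ZMod (2 * m)} :
    ZMod.castHom (dvd_mul_left m 2) (ZMod m) i = ZMod.castHom (dvd_mul_left m 2) (ZMod m) j ↔
      i + i = j + j := by
  obtain ⟨k, rfl⟩ := ZMod.intCast_surjective i
  obtain ⟨l, rfl⟩ := ZMod.intCast_surjective j
  have hm : ((2 * m : ℕ) : ℤ) ∣ l + l - (k + k) ↔ (m : ℤ) ∣ l - k := by
    rw [show l + l - (k + k) = 2 * (l - k) by ring, Nat.cast_mul, Nat.cast_ofNat]
    exact mul_dvd_mul_iff_left two_ne_zero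
  rw [map_intCast, map_intCast, ZMod.intCast_eq_intCast_iff_dvd_sub, ← hm,
    ← ZMod.intCast_eq_intCast_iff_dvd_sub]
  push_cast
  rfl

theorem one_add_one_ne_zero_of_two_le (hm : 2 ≤ m) : (1 + 1 : ZMod (2 * m)) ≠ 0 := by
  rw [one_add_one_eq_two]
  exact mt (ZMod.natCast_eq_zero_iff 2 (2 * m)).mp
    (Nat.not_dvd_of_pos_of_lt two_pos (by omega))

theorem commute_a_xa_iff {i j : ZMod (2 * m)} : Commute (a i) (xa j) ↔ i + i = 0 := by
  rw [commute_iff_eq, a_mul_xa, xa_mul_a, xa.injEq, sub_eq_iff_eq_add, add_assoc, left_eq_add]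

theorem commute_xa_xa_iff {i j : ZMod (2 * m)} : Commute (xa i) (xa j) ↔ i + i = j + j := by
  rw [commute_iff_eq, xa_mul_xa, xa_mul_xa, a.injEq, sub_eq_sub_iff_add_eq_add, add_assoc,
    add_assoc, add_right_inj, eq_comm]

theorem cyclicPair_a_a [NeZero m] (i j : ZMod (2 * m)) : CyclicPair (a i) (a j) := by
  have a_mem_zpowers (k : ZMod (2 * m)) : a k ∈ Subgroup.zpowers (a 1) := by
    rw [← ZMod.natCast_zmod_val k, ← a_one_pow]
    exact Subgroup.npow_mem_zpowers _ _
  exact ⟨a 1, a_mem_zpowers i, a_mem_zpowers j⟩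

theorem a_mem_zpowers_xa [NeZero m] {i : ZMod (2 * m)} (hi : i + i = 0) (j : ZMod (2 * m)) :
    a i ∈ Subgroup.zpowers (xa j) := by
  obtain ⟨k, hk⟩ : m ∣ i.val := by
    rw [← ZMod.natCast_eq_zero_iff, ← map_natCast (ZMod.castHom (dvd_mul_left m 2) (ZMod m)),
      ZMod.natCast_zmod_val, ← map_zero (ZMod.castHom (dvd_mul_left m 2) (ZMod m)),
      castHom_eq_castHom_iff, hi, add_zero]
  have a_eq_pow : a i = (xa j ^ 2) ^ k := by
    rw [xa_sq, ← a_one_pow, ← pow_mul, a_one_pow, ← hk, ZMod.natCast_zmod_val]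
  exact a_eq_pow ▸ pow_mem (Subgroup.npow_mem_zpowers _ 2) k

theorem a_mem_cyclicizer_iff [NeZero m] {i : ZMod (2 * m)} :
    a i ∈ cyclicizer (QuaternionGroup m) ↔ i + i = 0 := by
  refine ⟨fun h => commute_a_xa_iff.mp (h (xa 0)).commute, fun hi y => ?_⟩
  cases y with
  | a j => exact cyclicPair_a_a i j
  | xa j => exact .of_mem_zpowers (a_mem_zpowers_xa hi j)

theorem xa_not_mem_cyclicizer (hm : 2 ≤ m) (i : ZMod (2 * m)) :
    xa i ∉ cyclicizer (QuaternionGroup m) := fun h =>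
  one_add_one_ne_zero_of_two_le hm (commute_a_xa_iff.mp (h (a 1)).commute.symm)

theorem inv_ne_self_of_not_mem_cyclicizer (hm : 2 ≤ m) {x : QuaternionGroup m}
    (hx : x ∉ cyclicizer (QuaternionGroup m)) : x⁻¹ ≠ x := by
  have : NeZero m := ⟨by omega⟩
  rw [Ne, inv_eq_iff_mul_eq_one]
  cases x with
  | a i => rwa [a_mul_a, one_def, a.injEq, ← a_mem_cyclicizer_iff]
  | xa i =>
    rw [xa_mul_xa, add_sub_cancel_right, one_def, a.injEq, ZMod.natCast_eq_zero_iff]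
    exact Nat.not_dvd_of_pos_of_lt (by omega) (by omega)

theorem isCyclicLabelling_maxCyclicIndex (hm : 2 ≤ m) :
    IsCyclicLabelling (maxCyclicIndex : QuaternionGroup m → Option (ZMod m)) where
  cyclicPair_iff {x y} hx hy := by
    have : NeZero m := ⟨by omega⟩
    have not_cyclicPair {i j : ZMod (2 * m)} (hi : a i ∉ cyclicizer (QuaternionGroup m)) :
        ¬ CyclicPair (a i) (xa j) := fun h =>
      hi (a_mem_cyclicizer_iff.mpr (commute_a_xa_iff.mp h.commute))
    match x, y with
    | a i, a j => exact iff_of_true (cyclicPair_a_a i j) rfl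
    | a i, xa j => exact iff_of_false (not_cyclicPair hx) (Option.some_ne_none _).symm
    | xa i, a j => exact iff_of_false (mt .symm (not_cyclicPair hy)) (Option.some_ne_none _)
    | xa i, xa j =>
      rw [maxCyclicIndex, maxCyclicIndex, Option.some.injEq, castHom_eq_castHom_iff]
      refine ⟨fun h => commute_xa_xa_iff.mp h.commute, fun hij => .symm (.of_mem_zpowers ?_)⟩
      have hji : (j - i) + (j - i) = 0 := by rw [← add_sub_add_comm, hij, sub_self]
      rw [← add_sub_cancel i j, ← xa_mul_a]
      exact mul_mem (Subgroup.mem_zpowers _) (a_mem_zpowers_xa hji i)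
  exists_apply_eq
    | none => by
      have : NeZero m := ⟨by omega⟩
      exact ⟨a 1, mt a_mem_cyclicizer_iff.mp (one_add_one_ne_zero_of_two_le hm), rfl⟩
    | some c => by
      obtain ⟨i, rfl⟩ := ZMod.castHom_surjective (dvd_mul_left m 2) c
      exact ⟨xa i, xa_not_mem_cyclicizer hm i, rfl⟩

theorem strongDominationNumber_cyclic_prod_quaternionGroup {C : Type*} [Group C] [IsCyclic C]
    (hm : 2 ≤ m) (hC : (Nat.card C).Coprime (Nat.card (QuaternionGroup m))) :
    strongDominationNumber (properEnhancedPowerGraph (C × QuaternionGroup m)) = 2 * (m + 1) := by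
  have : NeZero m := ⟨by omega⟩
  rw [((isCyclicLabelling_maxCyclicIndex hm).comp_snd hC).strongDominationNumber_eq fun x hx hx' =>
    inv_ne_self_of_not_mem_cyclicizer hm (fun hx₂ => hx <| (mem_cyclicizer_prod_iff hC).mpr
      ⟨mem_cyclicizer_of_isCyclic _, hx₂⟩) (congrArg Prod.snd hx'),
    Fintype.card_option, ZMod.card]

theorem strongDominationNumber_prod_cyclic_prod_quaternionGroup {A C : Type*} [Group A] [Group C]
    [IsCyclic C] (hm : 2 ≤ m) (hA : IsNoncyclicPart A) (hA2 : (Nat.card A).Coprime 2)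
    (h : (Nat.card A).Coprime (Nat.card (C × QuaternionGroup m)))
    (hC : (Nat.card C).Coprime (Nat.card (QuaternionGroup m))) :
    strongDominationNumber (properEnhancedPowerGraph (A × C × QuaternionGroup m)) =
      min (minNumPrimeSubgroups A) (m + 1) + 1 := by
  have : NeZero m := ⟨by omega⟩
  rw [((isCyclicLabelling_maxCyclicIndex hm).comp_snd hC).strongDominationNumber_prod hA hA2 h,
    Fintype.card_option, ZMod.card]

end Quaternion

section Decomposition

theorem nonempty_sylow_mulEquiv {G A B : Type*} [Group G] [Group A] [Group B] [Finite A] [Finite B]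
    {p : ℕ} [Fact p.Prime] (e : G ≃* A × B) (hB : ¬ p ∣ Nat.card B) (P : Sylow p A)
    (S : Sylow p G) : Nonempty (P ≃* S) := by
  have : Finite G := Finite.of_equiv _ e.symm.toEquiv
  let f : A →* G := e.symm.toMonoidHom.comp (MonoidHom.inl A B)
  let ε : P ≃* P.1.map f :=
    P.1.equivMapOfInjective f (e.symm.injective.comp (Prod.mk_left_injective 1))
  have card_map : Nat.card (P.1.map f) = p ^ (Nat.card G).factorization p := by
    rw [← Nat.card_congr ε.toEquiv, P.card_eq_multiplicity, Nat.card_congr e.toEquiv, Nat.card_prod,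
      Nat.factorization_mul Nat.card_pos.ne' Nat.card_pos.ne', Finsupp.add_apply,
      Nat.factorization_eq_zero_of_not_dvd hB, add_zero]
  exact ⟨ε.trans ((Sylow.ofCard _ card_map).equiv S)⟩

variable {G : Type u} [Group G] [Finite G] [Group.IsNilpotent G]

theorem exists_mulEquiv_sylow_prod {p : ℕ} [hp : Fact p.Prime] (S : Sylow p G) :
    ∃ B : Subgroup G, ¬ p ∣ Nat.card B ∧ Nonempty (G ≃* S × B) := by
  obtain ⟨A, B, hA, hB, ⟨e⟩⟩ := exists_mulEquiv_prod G (· = p)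
  have not_dvd_card : ¬ p ∣ Nat.card B := fun hpB => hB p hp.out hpB rfl
  have isPGroup_A : IsPGroup p A := IsPGroup.of_card
    (Nat.eq_prime_pow_of_unique_prime_dvd Nat.card_pos.ne' fun {q} => hA q)
  let T : Sylow p A := (isPGroup_A.to_subgroup ⊤).toSylow (by simpa using hp.out.ne_one)
  obtain ⟨τ⟩ := nonempty_sylow_mulEquiv e not_dvd_card T S
  exact ⟨B, not_dvd_card, ⟨e.trans ((Subgroup.topEquiv.symm.trans τ).prodCongr (.refl B))⟩⟩

theorem isCyclic_of_forall_sylow_isCyclic {C : Subgroup G}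
    (h : ∀ p, p.Prime → p ∣ Nat.card C → ∀ P : Sylow p G, IsCyclic P) : IsCyclic C := by
  have : IsZGroup C := ⟨fun p hp P => by
    have := Fact.mk hp
    by_cases hpC : p ∣ Nat.card C
    · obtain ⟨Q, hPQ⟩ := (P.isPGroup'.map C.subtype).exists_le_sylow
      have := h p hp hpC Q
      have := Subgroup.isCyclic_of_le hPQ
      exact (P.1.equivMapOfInjective _ C.subtype_injective).isCyclic.mpr this
    · have card_P : Nat.card P = 1 := by
        rw [P.card_eq_multiplicity, Nat.factorization_eq_zero_of_not_dvd hpC, pow_zero]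
      have := (Nat.card_eq_one_iff_unique.mp card_P).1
      infer_instance⟩
  infer_instance

variable (G) in
theorem exists_mulEquiv_prod_isCyclic : ∃ G₁ C : Subgroup G,
    (∀ p : ℕ, p.Prime → p ∣ Nat.card G₁ → ∀ P : Sylow p G₁, ¬ IsCyclic P) ∧ IsCyclic C ∧
      (Nat.card G₁).Coprime (Nat.card C) ∧ Nonempty (G ≃* G₁ × C) := by
  obtain ⟨G₁, C, hG₁, hC, ⟨e⟩⟩ := exists_mulEquiv_prod G fun p => ∃ P : Sylow p G, ¬ IsCyclic P
  refine ⟨G₁, C, fun p hp hpG₁ P hP => ?_, ?_, ?_, ⟨e⟩⟩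
  · have := Fact.mk hp
    obtain ⟨S, hS⟩ := hG₁ p hp hpG₁
    obtain ⟨τ⟩ := nonempty_sylow_mulEquiv e (fun hpC => hC p hp hpC ⟨S, hS⟩) P S
    exact hS (τ.isCyclic.mp hP)
  · exact isCyclic_of_forall_sylow_isCyclic fun p hp hpC => by simpa using hC p hp hpC
  · exact Nat.coprime_of_dvd fun p hp hpG₁ hpC => hC p hp hpC (hG₁ p hp hpG₁)

theorem card_genQuaternion {k : ℕ} (hk : 2 ≤ k) : Nat.card (GenQuaternion k) = 2 ^ k := by
  have : NeZero (2 ^ (k - 2)) := ⟨by positivity⟩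
  rw [Nat.card_eq_fintype_card, QuaternionGroup.card]
  exact pow_mul_pow_sub 2 hk

theorem coprime_card_genQuaternion {k n : ℕ} (hk : 2 ≤ k) (hn : n.Coprime 2) :
    n.Coprime (Nat.card (GenQuaternion k)) := by
  rw [card_genQuaternion hk]
  exact hn.pow_right k

theorem isNoncyclicPart_of_coprime_two [Nontrivial G] (h2 : (Nat.card G).Coprime 2)
    (h : ∀ p : ℕ, p.Prime → p ∣ Nat.card G → ∀ P : Sylow p G, ¬ IsCyclic P) :
    IsNoncyclicPart G where
  finite := inferInstance
  nontrivial := inferInstance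
  nilpotent := inferInstance
  sylow p hp hpG P := by
    refine ⟨h p hp hpG P, ?_⟩
    rintro ⟨l, hl, ⟨τ⟩⟩
    have two_dvd_card : 2 ∣ Nat.card P := by
      rw [Nat.card_congr τ.toEquiv, card_genQuaternion (by omega)]
      exact dvd_pow_self 2 (by omega)
    exact Nat.not_coprime_of_dvd_of_dvd one_lt_two
      (two_dvd_card.trans (Subgroup.card_subgroup_dvd_card P.1)) dvd_rfl h2

theorem exists_decomposition {k : ℕ} (S : Sylow 2 G) (hS : Nonempty (S ≃* GenQuaternion k)) :
    (∃ n : ℕ, Nat.Coprime n 2 ∧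
        Nonempty (G ≃* Multiplicative (ZMod n) × GenQuaternion k)) ∨
      (∃ (G₁ : Type u) (_ : Group G₁) (n : ℕ), IsNoncyclicPart G₁ ∧
        Nat.Coprime (Nat.card G₁) n ∧ Nat.Coprime (Nat.card G₁) 2 ∧ Nat.Coprime n 2 ∧
        Nonempty (G ≃* G₁ × Multiplicative (ZMod n) × GenQuaternion k)) := by
  obtain ⟨σ⟩ := hS
  obtain ⟨B, h2B, ⟨e⟩⟩ := exists_mulEquiv_sylow_prod S
  obtain ⟨G₁, C, hG₁, hC, hcop, ⟨e'⟩⟩ := exists_mulEquiv_prod_isCyclic B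
  have coprime_two (H : Subgroup B) : (Nat.card H).Coprime 2 :=
    Nat.coprime_comm.mp (Nat.prime_two.coprime_iff_not_dvd.mpr fun h2 =>
      h2B (h2.trans (Subgroup.card_subgroup_dvd_card H)))
  let ε : G ≃* G₁ × Multiplicative (ZMod (Nat.card C)) × GenQuaternion k :=
    e.trans <| MulEquiv.prodComm.trans <| (e'.prodCongr σ).trans <| MulEquiv.prodAssoc.trans <|
      (MulEquiv.refl G₁).prodCongr ((zmodCyclicMulEquiv hC).symm.prodCongr (.refl _))
  obtain hsub | hnt := subsingleton_or_nontrivial G₁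
  · have : Unique G₁ := uniqueOfSubsingleton 1
    exact Or.inl ⟨Nat.card C, coprime_two C, ⟨ε.trans MulEquiv.uniqueProd⟩⟩
  · exact Or.inr ⟨G₁, inferInstance, Nat.card C,
      isNoncyclicPart_of_coprime_two (coprime_two G₁) hG₁, hcop, coprime_two G₁, coprime_two C, ⟨ε⟩⟩

end Decomposition

section GenQuaternion

variable {G : Type u} [Group G] {k n : ℕ}

theorem two_le_two_pow_sub_two (hk : 3 ≤ k) : 2 ≤ 2 ^ (k - 2) :=
  Nat.le_self_pow (by omega) 2

theorem strongDominationNumber_of_mulEquiv_cyclic_prod (hk : 3 ≤ k) (hn : n.Coprime 2)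
    (e : G ≃* Multiplicative (ZMod n) × GenQuaternion k) :
    strongDominationNumber (properEnhancedPowerGraph G) = 2 ^ (k - 1) + 2 := by
  have card_zmod : Nat.card (Multiplicative (ZMod n)) = n := Nat.card_zmod n
  rw [strongDominationNumber_congr (properEnhancedPowerGraphIso e),
    strongDominationNumber_cyclic_prod_quaternionGroup (two_le_two_pow_sub_two hk)
      (by rw [card_zmod]; exact coprime_card_genQuaternion (by omega) hn),
    mul_add, ← pow_succ', show k - 2 + 1 = k - 1 by omega]

theorem strongDominationNumber_of_mulEquiv_noncyclic_prod (hk : 3 ≤ k) {G₁ : Type v} [Group G₁]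
    (hG : IsNoncyclicPart G₁) (hGn : (Nat.card G₁).Coprime n) (hG2 : (Nat.card G₁).Coprime 2)
    (hn : n.Coprime 2) (e : G ≃* G₁ × Multiplicative (ZMod n) × GenQuaternion k) :
    strongDominationNumber (properEnhancedPowerGraph G) =
      min (minNumPrimeSubgroups G₁) (2 ^ (k - 2) + 1) + 1 := by
  have card_zmod : Nat.card (Multiplicative (ZMod n)) = n := Nat.card_zmod n
  have coprime_card_prod :
      (Nat.card G₁).Coprime (Nat.card (Multiplicative (ZMod n) × GenQuaternion k)) := by
    rw [Nat.card_prod, card_zmod]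
    exact hGn.mul_right (coprime_card_genQuaternion (by omega) hG2)
  rw [strongDominationNumber_congr (properEnhancedPowerGraphIso e),
    strongDominationNumber_prod_cyclic_prod_quaternionGroup (two_le_two_pow_sub_two hk) hG hG2
      coprime_card_prod (by rw [card_zmod]; exact coprime_card_genQuaternion (by omega) hn)]

end GenQuaternion

end EnhancedPower

open EnhancedPower in
theorem mainTheorem4 {G : Type u} [Group G] [Finite G] [Group.IsNilpotent G]
    (k : ℕ) (hk : 3 ≤ k) (S : Sylow 2 G) (hS : Nonempty (S ≃* GenQuaternion k)) :
    -- the cases below (with `n = 1` allowed) exhaust all such `G`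
    ((∃ n : ℕ, Nat.Coprime n 2 ∧
        Nonempty (G ≃* Multiplicative (ZMod n) × GenQuaternion k)) ∨
      (∃ (G₁ : Type u) (_ : Group G₁) (n : ℕ), IsNoncyclicPart G₁ ∧
        Nat.Coprime (Nat.card G₁) n ∧ Nat.Coprime (Nat.card G₁) 2 ∧ Nat.Coprime n 2 ∧
        Nonempty (G ≃* G₁ × Multiplicative (ZMod n) × GenQuaternion k))) ∧
    (Nonempty (G ≃* GenQuaternion k) →
      strongDominationNumber (properEnhancedPowerGraph G) = 2 ^ (k - 1) + 2) ∧
    (∀ n : ℕ, Nat.Coprime n 2 →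
      Nonempty (G ≃* Multiplicative (ZMod n) × GenQuaternion k) →
      strongDominationNumber (properEnhancedPowerGraph G) = 2 ^ (k - 1) + 2) ∧
    (∀ (G₁ : Type v) [Group G₁], IsNoncyclicPart G₁ → Nat.Coprime (Nat.card G₁) 2 →
      Nonempty (G ≃* G₁ × GenQuaternion k) →
      strongDominationNumber (properEnhancedPowerGraph G) =
        min (minNumPrimeSubgroups G₁) (2 ^ (k - 2) + 1) + 1) ∧
    (∀ (G₁ : Type v) [Group G₁] (n : ℕ), IsNoncyclicPart G₁ →
      Nat.Coprime (Nat.card G₁) n → Nat.Coprime (Nat.card G₁) 2 → Nat.Coprime n 2 →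
      Nonempty (G ≃* G₁ × Multiplicative (ZMod n) × GenQuaternion k) →
      strongDominationNumber (properEnhancedPowerGraph G) =
        min (minNumPrimeSubgroups G₁) (2 ^ (k - 2) + 1) + 1) := by
  let e₁ : GenQuaternion k ≃* Multiplicative (ZMod 1) × GenQuaternion k :=
    MulEquiv.uniqueProd.symm
  refine ⟨exists_decomposition S hS, ?_, ?_, ?_, ?_⟩
  · rintro ⟨e⟩
    exact strongDominationNumber_of_mulEquiv_cyclic_prod hk (Nat.coprime_one_left 2) (e.trans e₁)
  · rintro n hn ⟨e⟩
    exact strongDominationNumber_of_mulEquiv_cyclic_prod hk hn e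
  · rintro G₁ _ hG hG2 ⟨e⟩
    exact strongDominationNumber_of_mulEquiv_noncyclic_prod hk hG (Nat.coprime_one_right _) hG2
      (Nat.coprime_one_left 2) (e.trans (MulEquiv.prodCongr (MulEquiv.refl G₁) e₁))
  · rintro G₁ _ n hG hGn hG2 hn ⟨e⟩
    exact strongDominationNumber_of_mulEquiv_noncyclic_prod hk hG hGn hG2 hn e
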